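/- Let $n\ge1$ and let $S$ be a set. For functions $f_1,\dots,f_n\colon S\to[0,\infty]$ and $j\in\{1,\dots,n\}$ let the $j$th order statistic be the pointwise $$f_{n:j}:=\min_{J\subseteq\{1,\dots,n\},\ |J|=j}\ \max_{i\in J} f_i .$$ For nonempty finite sets $\mathcal F_1,\dots,\mathcal F_n$ of functions $S\to[0,\infty]$ let $$\mathcal F_{n:j}:=\{f_{n:j}\colon (f_1,\dots,f_n)\in\mathcal F_1\times\dots\times\mathcal F_n\}$$ (a set, so each function is counted once). Use the conventions $0\cdot\infty:=\infty$ in products, and $0^r:=\infty$, $\infty^r:=0$ for $r<0$. (i) Let $(S,\Sigma,\mu)$ be a measure space, write $\mu(h):=\int_S h\,d\mu$, and let $\mathcal F_1,\dots,\mathcal F_n$ be nonempty finite sets of $\Sigma$-measurable functions $S\to[0,\infty]$. Then for every real $r<0$ $$\prod_{j=1}^n\sum_{f\in\mathcal F_j}\mu(f)^r\le\prod_{j=1}^n\sum_{h\in\mathcal F_{n:j}}\mu(h)^r .$$ (ii) Let $\mathcal F_1,\dots,\mathcal F_n$ be any nonempty finite sets of (not necessarily measurable) functions $S\to[0,\infty]$.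 Then $$\prod_{j=1}^n\sum_{f\in\mathcal F_j}\inf_S f\le\prod_{j=1}^n\sum_{h\in\mathcal F_{n:j}}\inf_S h .$$ In particular, both inequalities hold for $[0,\infty)$-valued functions. -/

import Mathlib

open MeasureTheory
open scoped ENNReal

/-- The `j`-th order statistic of `f = (f_1, …, f_n)`: the meet, over all subsets `J` of the index
set of cardinality `j`, of the joins of the `f_i` with `i ∈ J`.  Indices are shifted by one
(`j : Fin n` stands for the usual index `j + 1 ∈ {1, …, n}`).  Every `J` is non-empty and
there is at least one `J`, so `⊥` and `⊤` only serve to write finite joins and meets. -/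
def orderStat {L : Type*} [DistribLattice L] [BoundedOrder L] {n : ℕ}
    (f : Fin n → L) (j : Fin n) : L :=
  (Finset.powersetCard (j.val + 1) (Finset.univ : Finset (Fin n))).inf fun J => J.sup f

open Classical in
/-- The finite set `{f_{n:j} : f ∈ F_1 × ⋯ × F_n}` (each element counted once). -/
noncomputable def orderStatFamily {L : Type*} [DistribLattice L] [BoundedOrder L] {n : ℕ}
    (F : Fin n → Finset L) (j : Fin n) : Finset L :=
  (Fintype.piFinset F).image fun f => orderStat f j

open Classical in
/-- The product of `a_1, …, a_n ∈ [0, ∞]` under the convention `0 · ∞ := ∞`. -/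
noncomputable def prodTop {n : ℕ} (a : Fin n → ℝ≥0∞) : ℝ≥0∞ :=
  if ∃ j, a j = ∞ then ∞ else ∏ j, a j

/-! Both parts are instances of an n-function four-functions inequality: if a weight `α` satisfies
`∏ α (f i) ≤ ∏ α (orderStat f j)` for every choice of `f i ∈ F i`, the same holds for the sums over
the families (`prodTop_sum_le_prodTop_sum`).

For a two-element lattice, concavity of the logarithm bounds the log-ratio of the two sides below by
a weighted sum of log-ratios. Once the indices are sorted by weight, Abel summation reduces this to
0/1 weights, where the hypothesis applies. Induction on coordinates gives Boolean cubes, and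
finitely many threshold cuts carry function families into a cube.

It remains to check single tuples. For infima this is monotonicity of order statistics. For
integrals, the sum of the first k order statistics is at most any sum of k of the functions; so the
partial sums of their integrals are dominated by those of the sorted integrals of the `f i`. A
second Abel summation turns this into an inequality of products, which the negative power reverses.
-/

open scoped NNReal Topology

/-! ### Order statistics in lattices and chains -/

section OrderStat

variable {L : Type*} [DistribLattice L] [BoundedOrder L] {n : ℕ}

theorem orderStat_le_sup (f : Fin n → L) (j : Fin n) {J : Finset (Fin n)}
    (hJ : J.card = j.val + 1) : orderStat f j ≤ J.sup f :=
  Finset.inf_le (f := fun J : Finset (Fin n) => J.sup f)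
    (Finset.mem_powersetCard.2 ⟨Finset.subset_univ _, hJ⟩)

theorem orderStat_mono {f g : Fin n → L} (h : f ≤ g) (j : Fin n) :
    orderStat f j ≤ orderStat g j :=
  Finset.inf_mono_fun fun _ _ => Finset.sup_mono_fun fun i _ => h i

theorem orderStat_apply {ι : Type*} {M : Type*} [DistribLattice M] [BoundedOrder M]
    (f : Fin n → ι → M) (j : Fin n) (s : ι) :
    orderStat f j s = orderStat (fun i => f i s) j := by
  simp only [orderStat, Finset.inf_apply, Finset.sup_apply]

theorem map_orderStat {M : Type*} [DistribLattice M] [BoundedOrder M]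
    (φ : BoundedLatticeHom L M) (f : Fin n → L) (j : Fin n) :
    φ (orderStat f j) = orderStat (fun i => φ (f i)) j := by
  simp only [orderStat, map_finset_inf, map_finset_sup, Function.comp_def]

theorem orderStat_mem_orderStatFamily {F : Fin n → Finset L} {f : Fin n → L}
    (hf : ∀ i, f i ∈ F i) (j : Fin n) : orderStat f j ∈ orderStatFamily F j := by
  classical
  exact Finset.mem_image.2 ⟨f, Fintype.mem_piFinset.2 hf, rfl⟩

end OrderStat

/-- On a chain the order statistics are the values in increasing order. -/
theorem orderStat_eq_of_monotone {K : Type*} [LinearOrder K] [BoundedOrder K] {n : ℕ}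
    (a : Fin n → K) (σ : Equiv.Perm (Fin n)) (h : Monotone (a ∘ σ)) (j : Fin n) :
    orderStat a j = a (σ j) := by
  apply le_antisymm
  · refine (orderStat_le_sup a j (J := (Finset.Iic j).map σ.toEmbedding) (by simp)).trans ?_
    refine Finset.sup_le fun i hi => ?_
    obtain ⟨l, hl, rfl⟩ := Finset.mem_map.1 hi
    exact h (Finset.mem_Iic.1 hl)
  · refine Finset.le_inf fun J hJ => ?_
    have hc := (Finset.mem_powersetCard.1 hJ).2
    -- Pigeonhole: `J` has j + 1 elements, but only j indices precede rank j.
    obtain ⟨i, hi, hij⟩ : ∃ i ∈ J, i ∉ (Finset.Iio j).map σ.toEmbedding := by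
      apply Finset.exists_mem_notMem_of_card_lt_card
      simp [hc]
    have hle : j ≤ σ.symm i := by
      by_contra hlt
      exact hij (Finset.mem_map.2 ⟨σ.symm i, Finset.mem_Iio.2 (not_le.1 hlt), by simp⟩)
    have := h hle
    simp only [Function.comp_apply, Equiv.apply_symm_apply] at this
    exact this.trans (Finset.le_sup hi)

/-! ### Abel summation -/

section Abel

/-- A convex combination of the sums `∑ i < k, y i + ∑ k ≤ i < n, x i` is nonnegative. -/
theorem sum_interpolate_nonneg (n : ℕ) (w x y : ℕ → ℝ) (hw : Antitone w) (hw1 : w 0 ≤ 1)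
    (hw0 : 0 ≤ w n)
    (h : ∀ k ≤ n, 0 ≤ ∑ i ∈ Finset.range n, (if i < k then y i else x i)) :
    0 ≤ ∑ i ∈ Finset.range n, ((1 - w i) * x i + w i * y i) := by
  set X := ∑ i ∈ Finset.range n, x i with hX
  have hD : ∀ k ≤ n, 0 ≤ X + ∑ i ∈ Finset.range k, (y i - x i) := by
    intro k hk
    have e : ∑ i ∈ Finset.range n, (if i < k then y i else x i)
        = X + ∑ i ∈ Finset.range k, (y i - x i) := by
      have hf : Finset.range k = (Finset.range n).filter (· < k) := by
        ext i; simp only [Finset.mem_range, Finset.mem_filter]; omega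
      rw [hf, Finset.sum_filter, hX, ← Finset.sum_add_distrib]
      refine Finset.sum_congr rfl fun i _ => ?_
      split_ifs <;> ring
    exact e ▸ h k hk
  -- Abel summation as an induction: with D k the bracketed sum, the new term turns `w k * D k` into
  -- `w k * D (k + 1)`, which is at least `w (k + 1) * D (k + 1)`.
  have key : ∀ k ≤ n, -X + w k * (X + ∑ i ∈ Finset.range k, (y i - x i))
      ≤ ∑ i ∈ Finset.range k, w i * (y i - x i) := by
    intro k
    induction k with
    | zero =>
      intro _
      have := hD 0 (Nat.zero_le _)
      simp only [Finset.range_zero, Finset.sum_empty, add_zero] at this ⊢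
      nlinarith
    | succ k ih =>
      intro hk
      have h1 := ih (by omega)
      have h2 := mul_le_mul_of_nonneg_right (hw (Nat.le_succ k)) (hD (k + 1) hk)
      rw [Finset.sum_range_succ _ k] at h2 ⊢
      rw [Finset.sum_range_succ _ k]
      simp only [Nat.succ_eq_add_one] at h2
      nlinarith
  have h1 := key n le_rfl
  have h2 := mul_nonneg hw0 (hD n le_rfl)
  have e : ∑ i ∈ Finset.range n, ((1 - w i) * x i + w i * y i)
      = X + ∑ i ∈ Finset.range n, w i * (y i - x i) := by
    rw [hX, ← Finset.sum_add_distrib]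
    exact Finset.sum_congr rfl fun i _ => by ring
  linarith

theorem sum_interpolate_nonneg_fin {n : ℕ} (w x y : Fin n → ℝ) (hw : Antitone w)
    (hw1 : ∀ i, w i ≤ 1) (hw0 : ∀ i, 0 ≤ w i)
    (h : ∀ k ≤ n, 0 ≤ ∑ i : Fin n, (if i.val < k then y i else x i)) :
    0 ≤ ∑ i, ((1 - w i) * x i + w i * y i) := by
  -- Extension by zero keeps the nonnegative `w` antitone.
  let ext (u : Fin n → ℝ) (i : ℕ) : ℝ := if hi : i < n then u ⟨i, hi⟩ else 0
  have hext : ∀ (u : Fin n → ℝ) (i : Fin n), ext u i = u i := fun u i => by simp [ext]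
  have := sum_interpolate_nonneg n (ext w) (ext x) (ext y) ?_ ?_ ?_ ?_
  · simpa only [Finset.sum_range, hext] using this
  · intro i j hij
    simp only [ext]
    split_ifs with hj hi hi
    · exact hw hij
    · omega
    · exact hw0 _
    · exact le_rfl
  · simp only [ext]
    split_ifs
    · exact hw1 _
    · exact zero_le_one
  · simp [ext]
  · intro k hk
    simpa only [Finset.sum_range, hext] using h k hk

end Abel

/-! ### The inequality on the two-element lattice -/

/-- Concavity of log at `b / a` and `c / a'`: with these weights their mean is `(b + c) / (a + a')`.
-/
theorem weighted_log_div_le {a a' b c : ℝ} (ha : 0 < a) (ha' : 0 < a') (hb : 0 < b) (hc : 0 < c) :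
    (1 - a' / (a + a')) * Real.log (b / a) + a' / (a + a') * Real.log (c / a')
      ≤ Real.log (b + c) - Real.log (a + a') := by
  have hs : 0 < a + a' := by positivity
  have hp : b / a ∈ Set.Ioi (0 : ℝ) := div_pos hb ha
  have hq : c / a' ∈ Set.Ioi (0 : ℝ) := div_pos hc ha'
  have h := strictConcaveOn_log_Ioi.concaveOn.2 hp hq (div_pos ha hs).le (div_pos ha' hs).le
    (by field_simp)
  have e : (a / (a + a')) • (b / a) + (a' / (a + a')) • (c / a') = (b + c) / (a + a') := by
    simp only [smul_eq_mul]; field_simp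
  rw [e, Real.log_div (add_pos hb hc).ne' hs.ne'] at h
  have e2 : 1 - a' / (a + a') = a / (a + a') := by field_simp; ring
  rw [e2]
  simpa only [smul_eq_mul] using h

/-- The weights from concavity are antitone in i, so by Abel summation only the initial segments
occurring in `h` need to be tested. -/
theorem prod_add_le_prod_add_of_antitone {n : ℕ} (a a' b c : Fin n → ℝ) (ha : ∀ i, 0 < a i)
    (ha' : ∀ i, 0 < a' i) (hb : ∀ i, 0 < b i) (hc : ∀ i, 0 < c i)
    (hanti : Antitone fun i => a' i / (a i + a' i))
    (h : ∀ k ≤ n, ∏ i : Fin n, (if i.val < k then a' i else a i)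
      ≤ ∏ i : Fin n, (if i.val < k then c i else b i)) :
    ∏ i, (a i + a' i) ≤ ∏ i, (b i + c i) := by
  have hs : ∀ i, 0 < a i + a' i := fun i => add_pos (ha i) (ha' i)
  have ht : ∀ i, 0 < b i + c i := fun i => add_pos (hb i) (hc i)
  rw [← Real.log_le_log_iff (Finset.prod_pos fun i _ => hs i) (Finset.prod_pos fun i _ => ht i),
    Real.log_prod fun i _ => (hs i).ne', Real.log_prod fun i _ => (ht i).ne', ← sub_nonneg,
    ← Finset.sum_sub_distrib]
  refine le_trans (sum_interpolate_nonneg_fin (fun i => a' i / (a i + a' i))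
    (fun i => Real.log (b i / a i)) (fun i => Real.log (c i / a' i)) hanti ?_ ?_ ?_)
    (Finset.sum_le_sum fun i _ => weighted_log_div_le (ha i) (ha' i) (hb i) (hc i))
  · exact fun i => (div_le_one (hs i)).2 (by linarith [ha i])
  · exact fun i => (div_pos (ha' i) (hs i)).le
  · intro k hk
    have hp : ∀ i : Fin n, 0 < (if i.val < k then a' i else a i) := fun i => by
      split_ifs <;> [exact ha' i; exact ha i]
    have hq : ∀ i : Fin n, 0 < (if i.val < k then c i else b i) := fun i => by
      split_ifs <;> [exact hc i; exact hb i]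
    have := Real.log_le_log (Finset.prod_pos fun i _ => hp i) (h k hk)
    rw [Real.log_prod fun i _ => (hp i).ne', Real.log_prod fun i _ => (hq i).ne', ← sub_nonneg,
      ← Finset.sum_sub_distrib] at this
    refine this.trans_eq (Finset.sum_congr rfl fun i _ => ?_)
    split_ifs
    · rw [Real.log_div (hc i).ne' (ha' i).ne']
    · rw [Real.log_div (hb i).ne' (ha i).ne']

/-- Sorting by decreasing share of `α i true` leaves only those `ε` that are true exactly on the
first k sorted indices. Their order statistics list false first, hence the reversal of `β`. -/
theorem prod_add_le_prod_add_of_pos {n : ℕ} (α β : Fin n → Bool → ℝ≥0)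
    (hα : ∀ i e, 0 < α i e) (hβ : ∀ i e, 0 < β i e)
    (h : ∀ ε : Fin n → Bool, ∏ i, α i (ε i) ≤ ∏ j, β j (orderStat ε j)) :
    ∏ i, (α i false + α i true) ≤ ∏ j, (β j false + β j true) := by
  let w : Fin n → ℝ := fun i => α i true / (α i false + α i true)
  let σ := Tuple.sort fun i => -w i
  have hσ : Antitone (w ∘ σ) := fun i j hij =>
    neg_le_neg_iff.1 (Tuple.monotone_sort (fun i => -w i) hij)
  have main := prod_add_le_prod_add_of_antitone (fun i => (α (σ i) false : ℝ))
    (fun i => (α (σ i) true : ℝ)) (fun i => (β i.rev false : ℝ)) (fun i => (β i.rev true : ℝ))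
    (fun i => hα _ _) (fun i => hα _ _) (fun i => hβ _ _) (fun i => hβ _ _) hσ ?_
  · rw [← NNReal.coe_le_coe]
    push_cast
    have hrev := Equiv.prod_comp Fin.revPerm fun i => (β i false + β i true : ℝ)
    simp only [Fin.revPerm_apply] at hrev
    rwa [Equiv.prod_comp σ (fun i => (α i false + α i true : ℝ)), hrev] at main
  · intro k hk
    let ε : Fin n → Bool := fun i => decide ((σ.symm i).val < k)
    have hε : ∀ j, orderStat ε j = decide (j.rev.val < k) := by
      intro j
      rw [orderStat_eq_of_monotone ε (Fin.revPerm.trans σ) ?_ j]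
      · simp [ε]
      · intro i j hij
        have hij' : i.val ≤ j.val := hij
        have := j.isLt
        simp only [ε, Function.comp_apply, Equiv.trans_apply, Equiv.symm_apply_apply,
          Fin.revPerm_apply, Fin.val_rev]
        intro hi
        simp only [decide_eq_true_eq] at hi ⊢
        omega
    have hk := NNReal.coe_le_coe.2 (h ε)
    simp only [hε] at hk
    push_cast at hk
    rw [← Equiv.prod_comp σ, ← Equiv.prod_comp Fin.revPerm (fun j => (β j _ : ℝ))] at hk
    simp only [ε, Equiv.symm_apply_apply, Fin.revPerm_apply, Fin.rev_rev] at hk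
    convert hk using 2 with i _ i _
    · split_ifs with hi <;> simp [hi]
    · split_ifs with hi <;> simp [hi]

/-- The Rinott–Saks / Aharoni–Keich inequality on the two-element lattice. -/
theorem prod_add_le_prod_add {n : ℕ} (α β : Fin n → Bool → ℝ≥0)
    (h : ∀ ε : Fin n → Bool, ∏ i, α i (ε i) ≤ ∏ j, β j (orderStat ε j)) :
    ∏ i, (α i false + α i true) ≤ ∏ j, (β j false + β j true) := by
  rcases isEmpty_or_nonempty (Fin n) with hn | hn
  · simp
  have hδ : ∀ δ : ℝ≥0, 0 < δ → ∏ i, (α i false + α i true)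
      ≤ ∏ j, ((β j false + δ) + (β j true + δ)) := by
    intro δ hδ
    -- Raising `β` by `δ` makes the hypothesis strict, which leaves room to raise `α` by a small `η`
    -- common to all of the finitely many `ε`.
    have hlt : ∀ ε : Fin n → Bool,
        ∏ i, α i (ε i) < ∏ j, (β j (orderStat ε j) + δ) := by
      intro ε
      refine (h ε).trans_lt ?_
      by_cases h0 : ∃ j, β j (orderStat ε j) = 0
      · obtain ⟨j, hj⟩ := h0
        rw [Finset.prod_eq_zero (Finset.mem_univ j) hj]
        exact Finset.prod_pos fun i _ => by positivity
      · push Not at h0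
        exact Finset.prod_lt_prod_of_nonempty (fun i _ => pos_iff_ne_zero.2 (h0 i))
          (fun i _ => lt_add_of_pos_right _ hδ) Finset.univ_nonempty
    have hev : ∀ᶠ η : ℝ≥0 in 𝓝 0, ∀ ε : Fin n → Bool,
        ∏ i, (α i (ε i) + η) < ∏ j, (β j (orderStat ε j) + δ) := by
      refine Filter.eventually_all.2 fun ε => ?_
      have hc : Continuous fun η : ℝ≥0 => ∏ i, (α i (ε i) + η) := by fun_prop
      exact hc.continuousAt.eventually_lt_const (by simpa using hlt ε)
    obtain ⟨η, hη, hη0⟩ :=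
      ((hev.filter_mono nhdsWithin_le_nhds).and (self_mem_nhdsWithin (s := Set.Ioi 0))).exists
    have hη0 : 0 < η := hη0
    refine le_trans (Finset.prod_le_prod' fun i _ => ?_)
      (prod_add_le_prod_add_of_pos (fun i e => α i e + η) (fun j e => β j e + δ)
        (fun i e => by positivity) (fun i e => by positivity) fun ε => (hη ε).le)
    exact add_le_add le_self_add le_self_add
  have hc : Continuous fun δ : ℝ≥0 => ∏ j, ((β j false + δ) + (β j true + δ)) := by fun_prop
  have hlim : Filter.Tendsto (fun δ : ℝ≥0 => ∏ j, ((β j false + δ) + (β j true + δ)))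
      (𝓝[>] 0) (𝓝 (∏ j, (β j false + β j true))) := by
    have := hc.tendsto 0
    simp only [add_zero] at this
    exact this.mono_left nhdsWithin_le_nhds
  exact ge_of_tendsto hlim (Filter.eventually_of_mem self_mem_nhdsWithin hδ)

/-! ### Boolean cubes and lattices of functions -/

theorem sum_fin_cons {m : ℕ} (g : (Fin (m + 1) → Bool) → ℝ≥0) :
    ∑ x, g x = ∑ y : Fin m → Bool,
      (g (Fin.cons (α := fun _ => Bool) false y) + g (Fin.cons (α := fun _ => Bool) true y)) := by
  rw [← (Fin.consEquiv fun _ : Fin (m + 1) => Bool).sum_comp, Fintype.sum_prod_type_right]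
  refine Finset.sum_congr rfl fun y _ => ?_
  rw [Fintype.sum_bool, add_comm]
  rfl

/-- The Rinott–Saks / Aharoni–Keich inequality on a finite Boolean lattice. -/
theorem prod_sum_le_prod_sum_cube {n : ℕ} (m : ℕ) (α β : Fin n → (Fin m → Bool) → ℝ≥0)
    (h : ∀ x : Fin n → Fin m → Bool, ∏ i, α i (x i) ≤ ∏ j, β j (orderStat x j)) :
    ∏ i, ∑ x, α i x ≤ ∏ j, ∑ x, β j x := by
  induction m with
  | zero =>
    simp only [Fintype.sum_unique]
    convert h fun _ => default
  | succ m ih =>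
    simp only [sum_fin_cons]
    -- For fixed remaining coordinates `y`, the two-element case in the first coordinate supplies
    -- the hypothesis for the weights summed over that coordinate.
    refine ih _ _ fun y => ?_
    refine prod_add_le_prod_add
      (fun i e => α i (Fin.cons (α := fun _ => Bool) e (y i)))
      (fun j e => β j (Fin.cons (α := fun _ => Bool) e (orderStat y j))) fun ε => ?_
    refine (h fun i => Fin.cons (ε i) (y i)).trans_eq (Finset.prod_congr rfl fun j _ => ?_)
    congr 1
    funext s
    rw [orderStat_apply]
    refine Fin.cases ?_ (fun s => ?_) s
    · simp
    · simp [orderStat_apply]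

/-- The Rinott–Saks / Aharoni–Keich inequality for a bounded lattice that embeds, on the relevant
finite sets, into a finite Boolean lattice. -/
theorem prod_sum_le_prod_sum_of_hom {L : Type*} [DistribLattice L] [BoundedOrder L] {n m : ℕ}
    (F : Fin n → Finset L) (α : L → ℝ≥0) (φ : L → Fin m → Bool)
    (hφ : ∀ (f : Fin n → L) (j : Fin n), φ (orderStat f j) = orderStat (fun i => φ (f i)) j)
    (hinj : ∀ j, Set.InjOn φ (F j))
    (h : ∀ f : Fin n → L, (∀ i, f i ∈ F i) → ∏ i, α (f i) ≤ ∏ j, α (orderStat f j)) :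
    ∏ i, ∑ f ∈ F i, α f ≤ ∏ j, ∑ g ∈ orderStatFamily F j, α g := by
  classical
  have main := prod_sum_le_prod_sum_cube m (fun i x => ∑ f ∈ F i with φ f = x, α f)
    (fun j x => ∑ g ∈ orderStatFamily F j with φ g = x, α g) fun x => ?_
  · simpa only [Finset.sum_fiberwise] using main
  by_cases hx : ∀ i, ∃ f ∈ F i, φ f = x i
  · choose f hfF hfx using hx
    -- Only the fibres in `F i` must be singletons; larger fibres among the order statistics merely
    -- increase the right side.
    have e : ∀ i, ({g ∈ F i | φ g = x i} : Finset L) = {f i} := by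
      intro i
      ext g
      simp only [Finset.mem_filter, Finset.mem_singleton]
      constructor
      · rintro ⟨hg, hgx⟩
        exact hinj i hg (hfF i) (hgx.trans (hfx i).symm)
      · rintro rfl
        exact ⟨hfF i, hfx i⟩
    simp only [e, Finset.sum_singleton]
    refine (h f hfF).trans (Finset.prod_le_prod' fun j _ => ?_)
    refine Finset.single_le_sum (f := α) (fun _ _ => zero_le) (Finset.mem_filter.2
      ⟨orderStat_mem_orderStatFamily hfF j, ?_⟩)
    rw [hφ]
    simp only [hfx]
  · push Not at hx
    obtain ⟨i, hi⟩ := hx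
    rw [Finset.prod_eq_zero (Finset.mem_univ i)]
    · exact zero_le
    · rw [Finset.filter_false_of_mem hi, Finset.sum_empty]

/-- Finitely many functions are separated by finitely many of the sets `{f | t < f s}`. -/
theorem exists_separating_cuts {S : Type*} (G : Finset (S → ℝ≥0∞)) :
    ∃ (m : ℕ) (p : Fin m → S × ℝ≥0∞), (∀ k, (p k).2 ≠ ∞) ∧
      Set.InjOn (fun (f : S → ℝ≥0∞) (k : Fin m) => decide ((p k).2 < f (p k).1)) G := by
  classical
  have hsep : ∀ q : (S → ℝ≥0∞) × (S → ℝ≥0∞), ∃ p : Option (S × ℝ≥0∞), q.1 ≠ q.2 →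
      ∃ r, p = some r ∧ r.2 ≠ ∞ ∧ decide (r.2 < q.1 r.1) ≠ decide (r.2 < q.2 r.1) := by
    rintro ⟨f, g⟩
    by_cases hfg : f = g
    · exact ⟨none, fun h => (h hfg).elim⟩
    · obtain ⟨s, hs⟩ := Function.ne_iff.1 hfg
      -- The threshold is the smaller of the two values, hence finite.
      rcases lt_or_gt_of_ne hs with hlt | hlt
      · exact ⟨some (s, f s), fun _ => ⟨_, rfl, hlt.ne_top, by simp [hlt]⟩⟩
      · exact ⟨some (s, g s), fun _ => ⟨_, rfl, hlt.ne_top, by simp [hlt]⟩⟩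
  choose c hc using hsep
  let T : Finset (S × ℝ≥0∞) := (((G ×ˢ G).image c).eraseNone).filter fun r => r.2 ≠ ∞
  refine ⟨T.card, fun k => (T.equivFin.symm k).1, fun k => ?_, ?_⟩
  · exact (Finset.mem_filter.1 (T.equivFin.symm k).2).2
  · intro f hf g hg hfg
    by_contra hne
    obtain ⟨r, hr, hr', hrne⟩ := hc (f, g) hne
    have hT : r ∈ T := by
      refine Finset.mem_filter.2 ⟨Finset.mem_eraseNone.2 ?_, hr'⟩
      rw [← hr]
      exact Finset.mem_image_of_mem c (Finset.mem_product.2 ⟨hf, hg⟩)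
    have := congrFun hfg (T.equivFin ⟨r, hT⟩)
    simp only [Equiv.symm_apply_apply] at this
    exact hrne this

theorem prod_sum_le_prod_sum {S : Type*} {n : ℕ} (F : Fin n → Finset (S → ℝ≥0∞))
    (α : (S → ℝ≥0∞) → ℝ≥0)
    (h : ∀ f : Fin n → S → ℝ≥0∞, (∀ i, f i ∈ F i) →
      ∏ i, α (f i) ≤ ∏ j, α (orderStat f j)) :
    ∏ i, ∑ f ∈ F i, α f ≤ ∏ j, ∑ g ∈ orderStatFamily F j, α g := by
  classical
  obtain ⟨m, p, hp, hinj⟩ := exists_separating_cuts (Finset.univ.biUnion F)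
  -- Each cut preserves joins and meets because `ℝ≥0∞` is a chain, and preserves `⊤` because the
  -- threshold is finite.
  let φ : BoundedLatticeHom (S → ℝ≥0∞) (Fin m → Bool) :=
    { toFun := fun f k => decide ((p k).2 < f (p k).1)
      map_sup' := fun f g => by funext k; simp [lt_sup_iff]
      map_inf' := fun f g => by funext k; simp [lt_inf_iff]
      map_top' := by funext k; simpa using (hp k).lt_top
      map_bot' := by funext k; simp }
  refine prod_sum_le_prod_sum_of_hom F α φ (map_orderStat φ) (fun j => hinj.mono ?_) h
  exact_mod_cast Finset.subset_biUnion_of_mem F (Finset.mem_univ j)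

/-! ### Products with 0 · ∞ = ∞ -/

theorem prodTop_of_ne_top {n : ℕ} {a : Fin n → ℝ≥0∞} (h : ∀ j, a j ≠ ∞) :
    prodTop a = ∏ j, a j := by
  rw [prodTop, if_neg (not_exists.2 h)]

theorem prodTop_of_eq_top {n : ℕ} {a : Fin n → ℝ≥0∞} (h : ∃ j, a j = ∞) : prodTop a = ∞ :=
  if_pos h

theorem prodTop_ne_top {n : ℕ} {a : Fin n → ℝ≥0∞} (h : ∀ j, a j ≠ ∞) : prodTop a ≠ ∞ := by
  rw [prodTop_of_ne_top h]
  exact ENNReal.prod_ne_top fun j _ => h j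

theorem prodTop_mono {n : ℕ} {a b : Fin n → ℝ≥0∞} (h : a ≤ b) : prodTop a ≤ prodTop b := by
  by_cases hb : ∃ j, b j = ∞
  · rw [prodTop_of_eq_top hb]
    exact le_top
  · push Not at hb
    rw [prodTop_of_ne_top hb, prodTop_of_ne_top fun j => ne_top_of_le_ne_top (hb j) (h j)]
    exact Finset.prod_le_prod' fun j _ => h j

theorem prodTop_comp_perm {n : ℕ} (a : Fin n → ℝ≥0∞) (σ : Equiv.Perm (Fin n)) :
    prodTop (fun j => a (σ j)) = prodTop a := by
  by_cases ha : ∃ j, a j = ∞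
  · rw [prodTop_of_eq_top ha, prodTop_of_eq_top]
    obtain ⟨j, hj⟩ := ha
    exact ⟨σ.symm j, by simpa using hj⟩
  · push Not at ha
    rw [prodTop_of_ne_top ha, prodTop_of_ne_top fun j => ha (σ j), Equiv.prod_comp σ a]

/-- The Rinott–Saks / Aharoni–Keich inequality for `[0, ∞]`-valued weights. -/
theorem prodTop_sum_le_prodTop_sum {S : Type*} {n : ℕ} (F : Fin n → Finset (S → ℝ≥0∞))
    (hF : ∀ j, (F j).Nonempty) (α : (S → ℝ≥0∞) → ℝ≥0∞)
    (h : ∀ f : Fin n → S → ℝ≥0∞, (∀ i, f i ∈ F i) →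
      prodTop (fun i => α (f i)) ≤ prodTop fun j => α (orderStat f j)) :
    prodTop (fun i => ∑ f ∈ F i, α f) ≤
      prodTop fun j => ∑ g ∈ orderStatFamily F j, α g := by
  classical
  by_cases htop : ∃ j, ∑ g ∈ orderStatFamily F j, α g = ∞
  · rw [prodTop_of_eq_top htop]
    exact le_top
  push Not at htop
  have hα : ∀ j, ∀ g ∈ orderStatFamily F j, α g ≠ ∞ := fun j => ENNReal.sum_ne_top.1 (htop j)
  -- An infinite weight, placed in a tuple completed arbitrarily from the nonempty families, would
  -- by `h` force an order statistic of infinite weight.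
  have hfin : ∀ j, ∀ f ∈ F j, α f ≠ ∞ := by
    intro j f hf hft
    choose f₀ hf₀ using hF
    have hg : ∀ i, Function.update f₀ j f i ∈ F i := by
      intro i
      by_cases hi : i = j
      · subst hi; simpa using hf
      · simpa [hi] using hf₀ i
    have := h _ hg
    rw [prodTop_of_eq_top ⟨j, by simpa using hft⟩, top_le_iff] at this
    exact prodTop_ne_top (fun j => hα j _ (orderStat_mem_orderStatFamily hg j)) this
  have hL : ∀ j, ∑ f ∈ F j, α f = ((∑ f ∈ F j, (α f).toNNReal : ℝ≥0) : ℝ≥0∞) := by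
    intro j
    push_cast
    exact Finset.sum_congr rfl fun f hf => (ENNReal.coe_toNNReal (hfin j f hf)).symm
  have hR : ∀ j, ∑ g ∈ orderStatFamily F j, α g
      = ((∑ g ∈ orderStatFamily F j, (α g).toNNReal : ℝ≥0) : ℝ≥0∞) := by
    intro j
    push_cast
    exact Finset.sum_congr rfl fun g hg => (ENNReal.coe_toNNReal (hα j g hg)).symm
  simp only [hL, hR]
  rw [prodTop_of_ne_top fun j => ENNReal.coe_ne_top, prodTop_of_ne_top fun j => ENNReal.coe_ne_top]
  have := prod_sum_le_prod_sum F (fun f => (α f).toNNReal) fun f hf => ?_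
  · exact_mod_cast this
  · have h1 := h f hf
    have h2 : ∀ j, α (orderStat f j) ≠ ∞ := fun j => hα j _ (orderStat_mem_orderStatFamily hf j)
    rw [prodTop_of_ne_top fun i => hfin i _ (hf i), prodTop_of_ne_top h2] at h1
    have h3 := ENNReal.toNNReal_mono (ENNReal.prod_ne_top fun j _ => h2 j) h1
    simpa only [ENNReal.toNNReal_prod] using h3

/-! ### Single tuples: infima and integrals -/

/-- The sorted infima are the order statistics of the constants `a i ≤ f i s`, so they lie below
those of the `f i` at every point. -/
theorem prodTop_iInf_le {S : Type*} {n : ℕ} (f : Fin n → S → ℝ≥0∞) :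
    prodTop (fun i => ⨅ s, f i s) ≤ prodTop fun j => ⨅ s, orderStat f j s := by
  let a : Fin n → ℝ≥0∞ := fun i => ⨅ s, f i s
  rw [← prodTop_comp_perm a (Tuple.sort a)]
  refine prodTop_mono fun j => le_iInf fun s => ?_
  change a (Tuple.sort a j) ≤ _
  rw [← orderStat_eq_of_monotone a _ (Tuple.monotone_sort a), orderStat_apply]
  exact orderStat_mono (fun i => iInf_le (f i) s) j

/-- The sum of the `#K` smallest order statistics is at most any sum of `#K` of the terms. -/
theorem sum_orderStat_le_sum {n : ℕ} (a : Fin n → ℝ≥0∞) (k : ℕ) (K : Finset (Fin n))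
    (hK : K.card = k) :
    ∑ j : Fin n with j.val < k, orderStat a j ≤ ∑ i ∈ K, a i := by
  induction k generalizing K with
  | zero => simp
  | succ k ih =>
    have hne : K.Nonempty := Finset.card_pos.1 (by omega)
    -- The largest of the k + 1 terms bounds the order statistic of index k; the others are left to
    -- the induction.
    obtain ⟨i, hi, hmax⟩ := Finset.exists_max_image K a hne
    have hkn : k < n := by
      have := Finset.card_le_univ K
      simp only [Fintype.card_fin] at this
      omega
    have e : (Finset.univ.filter fun j : Fin n => j.val < k + 1)
        = insert ⟨k, hkn⟩ (Finset.univ.filter fun j : Fin n => j.val < k) := by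
      ext j
      simp only [Finset.mem_filter, Finset.mem_univ, true_and, Finset.mem_insert, Fin.ext_iff]
      omega
    rw [e, Finset.sum_insert (by simp), ← Finset.add_sum_erase K a hi]
    refine add_le_add ?_ (ih (K.erase i) (by rw [Finset.card_erase_of_mem hi, hK]; rfl))
    exact (orderStat_le_sup a ⟨k, hkn⟩ hK).trans (Finset.sup_le hmax)

theorem sum_lintegral_orderStat_le {S : Type*} [MeasurableSpace S] (μ : Measure S) {n : ℕ}
    (f : Fin n → S → ℝ≥0∞) (hf : ∀ i, Measurable (f i)) (k : ℕ) (K : Finset (Fin n))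
    (hK : K.card = k) :
    ∑ j : Fin n with j.val < k, ∫⁻ s, orderStat f j s ∂μ ≤ ∑ i ∈ K, ∫⁻ s, f i s ∂μ := by
  -- Superadditivity of the lower integral needs no measurability, so none is required of the order
  -- statistics.
  have hsuper : ∀ (T : Finset (Fin n)) (g : Fin n → S → ℝ≥0∞),
      ∑ j ∈ T, ∫⁻ s, g j s ∂μ ≤ ∫⁻ s, ∑ j ∈ T, g j s ∂μ := by
    classical
    intro T g
    induction T using Finset.induction_on with
    | empty => simp
    | insert j T hj ih =>
      simp only [Finset.sum_insert hj]
      exact (add_le_add le_rfl ih).trans (le_lintegral_add _ _)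
  refine (hsuper _ _).trans ?_
  rw [← lintegral_finsetSum _ fun i _ => hf i]
  refine lintegral_mono fun s => ?_
  simp only [orderStat_apply]
  exact sum_orderStat_le_sum (fun i => f i s) k K hK

/-- If the partial sums of `M` are dominated by those of the increasing sequence `m`, then
`∏ M ≤ ∏ m`. -/
theorem prod_le_prod_of_partial_sums {n : ℕ} (m M : Fin n → ℝ) (hm : ∀ i, 0 < m i)
    (hM : ∀ i, 0 < M i) (hmono : Monotone m)
    (h : ∀ k ≤ n, ∑ j : Fin n with j.val < k, M j ≤ ∑ j : Fin n with j.val < k, m j) :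
    ∏ j, M j ≤ ∏ j, m j := by
  rcases n with _ | n
  · simp
  rw [← Real.log_le_log_iff (Finset.prod_pos fun i _ => hM i) (Finset.prod_pos fun i _ => hm i),
    Real.log_prod fun i _ => (hM i).ne', Real.log_prod fun i _ => (hm i).ne']
  -- The tangent bound log x ≤ x - 1 at x = M i / m i, scaled by `m 0` so that the weights `m 0 / m
  -- i` are at most 1; they are antitone since `m` is monotone.
  have hle : ∀ i, m 0 * (Real.log (M i) - Real.log (m i)) ≤ m 0 / m i * (M i - m i) := by
    intro i
    have h1 := Real.log_le_sub_one_of_pos (div_pos (hM i) (hm i))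
    rw [Real.log_div (hM i).ne' (hm i).ne'] at h1
    have e : m 0 / m i * (M i - m i) = m 0 * (M i / m i - 1) := by
      have := (hm i).ne'
      field_simp
    rw [e]
    exact mul_le_mul_of_nonneg_left h1 (hm 0).le
  have habel := sum_interpolate_nonneg_fin (fun i => m 0 / m i) (fun _ => 0)
    (fun i => m i - M i) (fun i j hij => div_le_div_of_nonneg_left (hm 0).le (hm i) (hmono hij))
    (fun i => (div_le_one (hm i)).2 (hmono (Fin.zero_le i)))
    (fun i => (div_pos (hm 0) (hm i)).le) fun k hk => by
      rw [← Finset.sum_filter, Finset.sum_sub_distrib]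
      exact sub_nonneg.2 (h k hk)
  have hsum : m 0 * ∑ i, (Real.log (M i) - Real.log (m i)) ≤ 0 := by
    rw [Finset.mul_sum]
    refine (Finset.sum_le_sum fun i _ => hle i).trans ?_
    rw [← neg_nonneg, ← Finset.sum_neg_distrib]
    refine habel.trans_eq (Finset.sum_congr rfl fun i _ => by ring)
  rw [← sub_nonpos, ← Finset.sum_sub_distrib]
  exact nonpos_of_mul_nonpos_right hsum (hm 0)

theorem prod_lintegral_orderStat_le {S : Type*} [MeasurableSpace S] (μ : Measure S) {n : ℕ}
    (f : Fin n → S → ℝ≥0∞) (hf : ∀ i, Measurable (f i)) (hfin : ∀ i, ∫⁻ s, f i s ∂μ ≠ ∞)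
    (hpos : ∀ j, ∫⁻ s, orderStat f j s ∂μ ≠ 0) (hpos' : ∀ i, ∫⁻ s, f i s ∂μ ≠ 0) :
    ∏ j, ∫⁻ s, orderStat f j s ∂μ ≤ ∏ i, ∫⁻ s, f i s ∂μ := by
  let m : Fin n → ℝ≥0∞ := fun i => ∫⁻ s, f i s ∂μ
  let M : Fin n → ℝ≥0∞ := fun j => ∫⁻ s, orderStat f j s ∂μ
  let σ := Tuple.sort m
  have hMfin : ∀ j, M j ≠ ∞ := by
    intro j
    have h1 := sum_lintegral_orderStat_le μ f hf n Finset.univ (by simp)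
    have h2 : M j ≤ ∑ j : Fin n with j.val < n, M j :=
      Finset.single_le_sum (f := M) (fun _ _ => zero_le) (by simp)
    exact ne_top_of_le_ne_top (ENNReal.sum_ne_top.2 fun i _ => hfin i) (h2.trans h1)
  have key := prod_le_prod_of_partial_sums (fun i => (m (σ i)).toReal) (fun j => (M j).toReal)
    (fun i => ENNReal.toReal_pos (hpos' _) (hfin _)) (fun i => ENNReal.toReal_pos (hpos i) (hMfin i))
    (fun i j hij => ENNReal.toReal_mono (hfin _) (Tuple.monotone_sort m hij)) ?_
  · rw [Equiv.prod_comp σ fun i => (m i).toReal, ← ENNReal.toReal_prod, ← ENNReal.toReal_prod,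
      ENNReal.toReal_le_toReal (ENNReal.prod_ne_top fun j _ => hMfin j)
        (ENNReal.prod_ne_top fun j _ => hfin j)] at key
    exact key
  · intro k hk
    rw [← ENNReal.toReal_sum fun j _ => hMfin j, ← ENNReal.toReal_sum fun j _ => hfin _]
    refine ENNReal.toReal_mono (ENNReal.sum_ne_top.2 fun j _ => hfin _) ?_
    -- The sharpest choice of `K`: the indices of the k smallest integrals.
    have := sum_lintegral_orderStat_le μ f hf k
      ((Finset.univ.filter fun j : Fin n => j.val < k).map σ.toEmbedding) (by
        rw [Finset.card_map, Fin.card_filter_val_lt, min_eq_right hk])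
    rwa [Finset.sum_map] at this

theorem prodTop_lintegral_rpow_le {S : Type*} [MeasurableSpace S] (μ : Measure S) {n : ℕ}
    (f : Fin n → S → ℝ≥0∞) (hf : ∀ i, Measurable (f i)) {r : ℝ} (hr : r < 0) :
    prodTop (fun i => (∫⁻ s, f i s ∂μ) ^ r) ≤
      prodTop fun j => (∫⁻ s, orderStat f j s ∂μ) ^ r := by
  by_cases htop : ∃ j, (∫⁻ s, orderStat f j s ∂μ) ^ r = ∞
  · rw [prodTop_of_eq_top htop]
    exact le_top
  push Not at htop
  have hiff : ∀ x : ℝ≥0∞, x ^ r = ∞ ↔ x = 0 := fun x => by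
    simp [ENNReal.rpow_eq_top_iff, hr, hr.not_gt]
  have hpos : ∀ j, ∫⁻ s, orderStat f j s ∂μ ≠ 0 := fun j h0 => htop j ((hiff _).2 h0)
  -- The lowest order statistic lies below every `f i`, so a null integral of some `f i` would make
  -- its integral zero too.
  have hpos' : ∀ i, ∫⁻ s, f i s ∂μ ≠ 0 := by
    intro i h0
    have hn : 0 < n := i.pos
    refine hpos ⟨0, hn⟩ (nonpos_iff_eq_zero.1 ((lintegral_mono ?_).trans_eq h0))
    have := orderStat_le_sup f ⟨0, hn⟩ (J := {i}) (by simp)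
    simpa using this
  rw [prodTop_of_ne_top htop, prodTop_of_ne_top fun i h0 => hpos' i ((hiff _).1 h0)]
  -- No factor on the left is infinite now, so an infinite integral makes the left side an ordinary
  -- product with a zero factor.
  by_cases hinf : ∃ i, ∫⁻ s, f i s ∂μ = ∞
  · obtain ⟨i, hi⟩ := hinf
    rw [Finset.prod_eq_zero (Finset.mem_univ i)]
    · exact zero_le
    · rw [hi, ENNReal.top_rpow_of_neg hr]
  · push Not at hinf
    have hle := prod_lintegral_orderStat_le μ f hf hinf hpos hpos'
    have hinv : ∀ x : ℝ≥0∞, x ^ r = (x ^ (-r))⁻¹ := fun x => by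
      rw [← ENNReal.rpow_neg, neg_neg]
    have hfac : ∀ a : Fin n → ℝ≥0∞, (∀ i, a i ≠ 0) →
        ∏ i, a i ^ r = ((∏ i, a i) ^ (-r))⁻¹ := by
      intro a ha
      simp only [hinv]
      rw [← ENNReal.prod_rpow_of_nonneg (by linarith), ENNReal.prod_inv_distrib]
      intro i _ j _ _
      left
      simp [ENNReal.rpow_eq_zero_iff, ha i, hr, hr.not_gt]
    rw [hfac _ hpos', hfac _ hpos, ENNReal.inv_le_inv]
    exact ENNReal.rpow_le_rpow hle (by linarith)

theorem corollary9 {S : Type*} (n : ℕ) :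
    (∀ [MeasurableSpace S] (μ : Measure S) (F : Fin n → Finset (S → ℝ≥0∞)),
      (∀ j, (F j).Nonempty) → (∀ j, ∀ f ∈ F j, Measurable f) →
      ∀ r : ℝ, r < 0 →
        prodTop (fun j => ∑ f ∈ F j, (∫⁻ s, f s ∂μ) ^ r) ≤
          prodTop (fun j => ∑ h ∈ orderStatFamily F j, (∫⁻ s, h s ∂μ) ^ r)) ∧
    (∀ F : Fin n → Finset (S → ℝ≥0∞),
      (∀ j, (F j).Nonempty) →
        prodTop (fun j => ∑ f ∈ F j, ⨅ s, f s) ≤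
          prodTop (fun j => ∑ h ∈ orderStatFamily F j, ⨅ s, h s)) := by
  refine ⟨fun μ F hF hmeas r hr => ?_, fun F hF => ?_⟩
  · exact prodTop_sum_le_prodTop_sum F hF (fun f => (∫⁻ s, f s ∂μ) ^ r) fun f hf =>
      prodTop_lintegral_rpow_le μ f (fun i => hmeas i _ (hf i)) hr
  · exact prodTop_sum_le_prodTop_sum F hF (fun f => ⨅ s, f s) fun f _ => prodTop_iInf_le f
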